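/- Let $n\ge 0$ be an integer, let $Q\in\mathbb R^{n\times n}$, $z\in\mathbb R^n$, $\Phi_1,\dots,\Phi_n\in\mathbb R^n$, and let $\lambda_1,\lambda_2>0$. Write $\langle A,B\rangle=\operatorname{tr}(A^\top B)$, let $\Phi(X)=(\langle X,\Phi_i\Phi_i^\top\rangle)_{i=1}^n$ for $X\in\mathbb R^{n\times n}$ and $\Phi^\star(\gamma)=\sum_{i=1}^n\gamma_i\Phi_i\Phi_i^\top$ for $\gamma\in\mathbb R^n$. Let $\mathcal S^n_+$ be the cone of symmetric positive semidefinite real $n\times n$ matrices, and let $\operatorname{proj}_{\mathcal S^n_+}(Z)$ be the point of $\mathcal S^n_+$ nearest to $Z\in\mathbb R^{n\times n}$ in the Frobenius norm. Equip $\mathbb R^n\times\mathbb R^{n\times n}$ with the norm $\|(\gamma,X)\|=\|\gamma\|_2+\|X\|_F$. Then the residual map $R:\mathbb R^n\times\mathbb R^{n\times n}\to\mathbb R^n\times\mathbb R^{n\times n}$, $$R(\gamma,X)=\begin{pmatrix}\tfrac1{2\lambda_2}Q\gamma-\tfrac1{2\lambda_2}z-\Phi(X)\\[2pt] X-\operatorname{proj}_{\mathcal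 S^n_+}\bigl(X-(\Phi^\star(\gamma)+\lambda_1 I)\bigr)\end{pmatrix},$$ is strongly semismooth. That is, $R$ is Lipschitz, and at every point $w$: (i) $R$ is directionally differentiable at $w$: for every direction $h$ the limit $\lim_{t\downarrow0}\bigl(R(w+th)-R(w)\bigr)/t$ exists; (ii) there are $C\ge 0$ and $\delta>0$ such that for all $\Delta w$ with $\|\Delta w\|<\delta$ and all $\mathcal J\in\partial R(w+\Delta w)$, $$\|R(w+\Delta w)-R(w)-\mathcal J[\Delta w]\|\le C\|\Delta w\|^2 .$$ Here $\partial R(w)$ is the generalized Jacobian, i.e. the convex hull of the set $\partial_B R(w)$ of all limits $\lim_k \nabla R(w^k)$ along sequences $w^k\to w$ of points at which $R$ is differentiable. -/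

import Mathlib

open Filter Topology
open scoped Matrix Matrix.Norms.Frobenius

noncomputable section

section Semismooth

variable {E F : Type*} [NormedAddCommGroup E] [NormedSpace ℝ E]
  [NormedAddCommGroup F] [NormedSpace ℝ F]

/-- The B-subdifferential of `f` at `w`: all limits of derivatives `∇f(wₖ)` along sequences
`wₖ → w` of points of differentiability. -/
def bSubdifferential (f : E → F) (w : E) : Set (E →L[ℝ] F) :=
  {J | ∃ u : ℕ → E, (∀ k, DifferentiableAt ℝ f (u k)) ∧ Tendsto u atTop (𝓝 w) ∧
    Tendsto (fun k => fderiv ℝ f (u k)) atTop (𝓝 J)}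

/-- Clarke's generalized Jacobian: the convex hull of the B-subdifferential. -/
def generalizedJacobian (f : E → F) (w : E) : Set (E →L[ℝ] F) :=
  convexHull ℝ (bSubdifferential f w)

/-- The one-sided directional derivative of `f` at `w` exists in every direction. -/
def DirectionallyDifferentiableAt (f : E → F) (w : E) : Prop :=
  ∀ h : E, ∃ d : F, Tendsto (fun t : ℝ => t⁻¹ • (f (w + t • h) - f w)) (𝓝[>] 0) (𝓝 d)

/-- Strong semismoothness at `w` (of a Lipschitz map): directional differentiability, and a
quadratic first-order error for all small increments `Δ`, uniformly over all elements of the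
generalized Jacobian at `w + Δ`. -/
def StronglySemismoothAt (f : E → F) (w : E) : Prop :=
  DirectionallyDifferentiableAt f w ∧
    ∃ C : ℝ, ∀ᶠ Δ in 𝓝 (0 : E), ∀ J ∈ generalizedJacobian f (w + Δ),
      ‖f (w + Δ) - f w - J Δ‖ ≤ C * ‖Δ‖ ^ 2

/-- A strongly semismooth map: a Lipschitz map that is strongly semismooth at every point. -/
def StronglySemismooth (f : E → F) : Prop :=
  (∃ L : NNReal, LipschitzWith L f) ∧ ∀ w, StronglySemismoothAt f w

end Semismooth

/-- The cone of symmetric positive semidefinite real `n × n` matrices. -/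
def psdCone (n : ℕ) : Set (Matrix (Fin n) (Fin n) ℝ) := {X | X.PosSemidef}

theorem isClosed_psdCone (n : ℕ) : IsClosed (psdCone n) := by
  have h : psdCone n = {X | Xᴴ = X} ∩ ⋂ v : Fin n → ℝ, {X | 0 ≤ star v ⬝ᵥ (X *ᵥ v)} := by
    ext X
    simp [psdCone, Matrix.posSemidef_iff_dotProduct_mulVec, Matrix.IsHermitian]
  rw [h]
  refine (isClosed_eq (by fun_prop) (by fun_prop)).inter (isClosed_iInter fun v => ?_)
  exact isClosed_le (by fun_prop) (by fun_prop)

theorem exists_nearest_psdCone {n : ℕ} (Z : Matrix (Fin n) (Fin n) ℝ) :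
    ∃ P ∈ psdCone n, ∀ Y ∈ psdCone n, ‖Z - P‖ ≤ ‖Z - Y‖ := by
  have : ProperSpace (Matrix (Fin n) (Fin n) ℝ) := FiniteDimensional.proper ℝ _
  obtain ⟨P, hP, h⟩ := (isClosed_psdCone n).exists_infDist_eq_dist
    ⟨0, Matrix.PosSemidef.zero⟩ Z
  refine ⟨P, hP, fun Y hY => ?_⟩
  rw [← dist_eq_norm, ← dist_eq_norm, ← h]
  exact Metric.infDist_le_dist_of_mem hY

/-- The projection of an arbitrary square matrix onto the positive semidefinite cone: its
nearest point in the cone for the Frobenius norm (unique because the cone is convex). -/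
def projPSD {n : ℕ} (Z : Matrix (Fin n) (Fin n) ℝ) : Matrix (Fin n) (Fin n) ℝ :=
  (exists_nearest_psdCone Z).choose

/-- Vector-matrix pairs `w = (γ, X)` with `‖w‖ = ‖γ‖₂ + ‖X‖_F`. -/
abbrev PairSpace (n : ℕ) : Type :=
  WithLp 1 (EuclideanSpace ℝ (Fin n) × Matrix (Fin n) (Fin n) ℝ)

/-- `Φ(X) = (⟨X, Φᵢ Φᵢᵀ⟩)ᵢ` with `⟨A, B⟩ = tr(Aᵀ B)`, for vectors `Φ₁, …, Φₙ`. -/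
def opPhi {n : ℕ} (Φ : Fin n → Fin n → ℝ) (X : Matrix (Fin n) (Fin n) ℝ) : Fin n → ℝ :=
  fun i => (Xᵀ * Matrix.vecMulVec (Φ i) (Φ i)).trace

/-- `Φ*(γ) = ∑ᵢ γᵢ Φᵢ Φᵢᵀ`. -/
def opPhiAdj {n : ℕ} (Φ : Fin n → Fin n → ℝ) (γ : Fin n → ℝ) : Matrix (Fin n) (Fin n) ℝ :=
  ∑ i, γ i • Matrix.vecMulVec (Φ i) (Φ i)

/-- The residual map `R(γ, X) = ((1/2λ₂) Q γ - (1/2λ₂) z - Φ(X), X - proj(X - (Φ*(γ) + λ₁ I)))`. -/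
def residualMap {n : ℕ} (Q : Matrix (Fin n) (Fin n) ℝ) (z : Fin n → ℝ)
    (Φ : Fin n → Fin n → ℝ) (lam₁ lam₂ : ℝ) (w : PairSpace n) : PairSpace n :=
  WithLp.toLp 1
    (WithLp.toLp 2
      ((1 / (2 * lam₂)) • (Q *ᵥ w.fst.ofLp) - (1 / (2 * lam₂)) • z - opPhi Φ w.snd),
     w.snd - projPSD (w.snd - (opPhiAdj Φ w.fst.ofLp + lam₁ • (1 : Matrix (Fin n) (Fin n) ℝ))))

end

/-! Up to affine maps, the residual is the projection `projPSD`, which is nonsmooth but Lipschitz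
and positively homogeneous. If P has these two properties and ψ is `C²` with ψ(w) = 0, then Euler's
identity bounds the error of P ∘ ψ, at any point u where it is differentiable, by K‖ψ(u) - ψ'(u)(u -
w)‖ = O(‖u - w‖²). Limits and convex hulls preserve the bound, so it holds on the generalized
Jacobian.

It remains to write the projection near any Z as F + `projPSD` ∘ G with F, G of class `C²` and G(Z)
= 0 (`exists_projPSD_eq_add_projPSD`). The projection takes the positive part of the eigenvalues of
the symmetric part; F collects the eigenvalues staying away from 0 and G those near 0. Both are
spectral functions with kinks off the spectrum at Z, hence smooth there by `contDiffAt_projPSD`. -/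

/-! ### A criterion for strong semismoothness. -/

section SemismoothCriterion

variable {E F G : Type*} [NormedAddCommGroup E] [NormedSpace ℝ E]
  [NormedAddCommGroup F] [NormedSpace ℝ F] [NormedAddCommGroup G] [NormedSpace ℝ G]

/-- The first-order expansion of a `C²` map with the derivative taken at the moving point. -/
theorem ContDiffAt.exists_norm_sub_sub_fderiv_le {f : E → F} {w : E} (hf : ContDiffAt ℝ 2 f w) :
    ∃ C : ℝ, ∀ᶠ u in 𝓝 w, DifferentiableAt ℝ f u ∧
      ‖f u - f w - fderiv ℝ f u (u - w)‖ ≤ C * ‖u - w‖ ^ 2 := by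
  obtain ⟨K, t, ht, hK⟩ := (hf.fderiv_right (m := 1) (by norm_num)).exists_lipschitzOnWith
  have hd : ∀ᶠ u in 𝓝 w, DifferentiableAt ℝ f u :=
    (hf.eventually (by simp)).mono fun u hu => hu.differentiableAt (by simp)
  obtain ⟨r, hr, hball⟩ := Metric.mem_nhds_iff.1 (inter_mem ht hd)
  refine ⟨K, ?_⟩
  filter_upwards [Metric.ball_mem_nhds w hr] with u hu
  refine ⟨(hball hu).2, ?_⟩
  have hseg : segment ℝ w u ⊆ Metric.ball w r :=
    (convex_ball w r).segment_subset (Metric.mem_ball_self hr) hu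
  -- Mean value inequality for `f - fderiv ℝ f u`, whose derivative on the segment has norm at most
  -- K‖u - w‖.
  have key := (convex_segment w u).norm_image_sub_le_of_norm_hasFDerivWithin_le'
    (f := f) (f' := fun x => fderiv ℝ f x) (φ := fderiv ℝ f u) (C := K * ‖u - w‖)
    (fun x hx => (hball (hseg hx)).2.hasFDerivAt.hasFDerivWithinAt)
    (fun x hx => by
      have h1 := hK.dist_le_mul x (hball (hseg hx)).1 u (hball hu).1
      rw [dist_eq_norm, dist_eq_norm] at h1
      refine h1.trans (mul_le_mul_of_nonneg_left ?_ K.2)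
      have h2 := norm_sub_le_of_mem_segment (segment_symm ℝ w u ▸ hx)
      rwa [norm_sub_rev u w] )
    (left_mem_segment ℝ w u) (right_mem_segment ℝ w u)
  calc _ ≤ _ := key
    _ = _ := by ring

/-- If `P` is Lipschitz and positively homogeneous and `P ∘ ψ` is differentiable at `u`, then its
derivative at `u` in a direction `Δ` is `P (ψ u)` up to the error `ψ u - ψ'(u) Δ`. -/
theorem norm_comp_sub_fderiv_le {P : G → F} {K : NNReal} (hP : LipschitzWith K P)
    (hom : ∀ t : ℝ, 0 ≤ t → ∀ x, P (t • x) = t • P x) {ψ : E → G} {u : E}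
    (hψ : DifferentiableAt ℝ ψ u) (hd : DifferentiableAt ℝ (fun x => P (ψ x)) u) (Δ : E) :
    ‖P (ψ u) - fderiv ℝ (fun x => P (ψ x)) u Δ‖ ≤ K * ‖ψ u - fderiv ℝ ψ u Δ‖ := by
  have h1 := (hd.hasFDerivAt.hasLineDerivAt Δ).tendsto_slope_zero_right
  have h2 := (hψ.hasFDerivAt.hasLineDerivAt Δ).tendsto_slope_zero_right
  refine le_of_tendsto_of_tendsto (tendsto_const_nhds.sub h1).norm
    ((tendsto_const_nhds.sub h2).norm.const_mul (K : ℝ)) ?_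
  filter_upwards [self_mem_nhdsWithin] with t ht
  have ht : 0 < t := ht
  -- By homogeneity P(ψ u) is itself a slope, that of P along the ray (1 + t)ψ u. The Lipschitz
  -- bound then compares two arguments of P, so P need not be differentiable.
  have e1 : P (ψ u) - t⁻¹ • (P (ψ (u + t • Δ)) - P (ψ u)) =
      t⁻¹ • (P ((1 + t) • ψ u) - P (ψ (u + t • Δ))) := by
    rw [hom _ (by positivity)]
    match_scalars <;> (field_simp; try ring)
  have e2 : ψ u - t⁻¹ • (ψ (u + t • Δ) - ψ u) = t⁻¹ • ((1 + t) • ψ u - ψ (u + t • Δ)) := by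
    match_scalars <;> (field_simp; try ring)
  rw [e1, e2, norm_smul, norm_smul, mul_left_comm]
  exact mul_le_mul_of_nonneg_left (hP.norm_sub_le _ _) (norm_nonneg _)

theorem directionallyDifferentiableAt_comp_of_homogeneous {P : G → F} (hP : Continuous P)
    (hom : ∀ t : ℝ, 0 ≤ t → ∀ x, P (t • x) = t • P x) {ψ : E → G} {w : E}
    (hψ : DifferentiableAt ℝ ψ w) (h0 : ψ w = 0) :
    DirectionallyDifferentiableAt (fun x => P (ψ x)) w := by
  intro h
  have h2 := (hψ.hasFDerivAt.hasLineDerivAt h).tendsto_slope_zero_right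
  refine ⟨_, ((hP.tendsto _).comp h2).congr' ?_⟩
  filter_upwards [self_mem_nhdsWithin] with t ht
  have ht : 0 < t := ht
  have hP0 : P 0 = 0 := by simpa using hom 0 le_rfl 0
  simp [h0, hP0, hom _ (inv_nonneg.2 ht.le)]

/-- The estimate is closed under limits of (u, J), and for fixed Δ it is a convex condition on J, so
derivatives at differentiability points suffice. -/
theorem StronglySemismoothAt.of_eventually_differentiableAt {f : E → F} {w : E}
    (hc : Continuous f) (hdir : DirectionallyDifferentiableAt f w) {C : ℝ}
    (h : ∀ᶠ u in 𝓝 w, DifferentiableAt ℝ f u →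
      ‖f u - f w - fderiv ℝ f u (u - w)‖ ≤ C * ‖u - w‖ ^ 2) :
    StronglySemismoothAt f w := by
  refine ⟨hdir, C, ?_⟩
  have hmap : Tendsto (fun Δ : E => w + Δ) (𝓝 0) (𝓝 w) := by
    simpa using (continuous_const_add w).tendsto (0 : E)
  filter_upwards [hmap.eventually h.eventually_nhds] with Δ hΔ
  have hconv : Convex ℝ {J : E →L[ℝ] F | ‖f (w + Δ) - f w - J Δ‖ ≤ C * ‖Δ‖ ^ 2} := by
    have := (convex_closedBall (f (w + Δ) - f w) (C * ‖Δ‖ ^ 2)).linear_preimage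
      (ContinuousLinearMap.apply ℝ F Δ).toLinearMap
    have heq : {J : E →L[ℝ] F | ‖f (w + Δ) - f w - J Δ‖ ≤ C * ‖Δ‖ ^ 2} =
        (ContinuousLinearMap.apply ℝ F Δ).toLinearMap ⁻¹'
          Metric.closedBall (f (w + Δ) - f w) (C * ‖Δ‖ ^ 2) := by
      refine Set.ext fun J => ?_
      simp [dist_eq_norm, norm_sub_rev (J Δ)]
    rwa [heq]
  refine fun J hJ => convexHull_min ?_ hconv hJ
  rintro J ⟨u, hud, hu, hJ⟩
  have hsub : Tendsto (fun k => u k - w) atTop (𝓝 Δ) := by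
    simpa using hu.sub_const w
  refine le_of_tendsto_of_tendsto
    ((((hc.tendsto _).comp hu).sub_const (f w)).sub
      (isBoundedBilinearMap_apply.continuous.tendsto (J, Δ) |>.comp (hJ.prodMk_nhds hsub))).norm
    ((hsub.norm.pow 2).const_mul C) ?_
  filter_upwards [hu.eventually hΔ] with k hk using hk (hud k)

/-- A map which near `w` is the sum of a `C²` map and of a Lipschitz positively homogeneous
function of a `C²` map vanishing at `w` is strongly semismooth at `w`. -/
theorem StronglySemismoothAt.of_eventuallyEq_add_comp {f φ : E → F} {ψ : E → G} {P : G → F}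
    {K : NNReal} {w : E} (hc : Continuous f) (hφ : ContDiffAt ℝ 2 φ w) (hψ : ContDiffAt ℝ 2 ψ w)
    (h0 : ψ w = 0) (hP : LipschitzWith K P) (hom : ∀ t : ℝ, 0 ≤ t → ∀ x, P (t • x) = t • P x)
    (hf : ∀ᶠ u in 𝓝 w, f u = φ u + P (ψ u)) : StronglySemismoothAt f w := by
  have hP0 : P 0 = 0 := by simpa using hom 0 le_rfl 0
  obtain ⟨C₁, h₁⟩ := hφ.exists_norm_sub_sub_fderiv_le
  obtain ⟨C₂, h₂⟩ := hψ.exists_norm_sub_sub_fderiv_le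
  refine .of_eventually_differentiableAt hc (fun h => ?_) (C := C₁ + K * C₂) ?_
  · obtain ⟨d, hd⟩ := directionallyDifferentiableAt_comp_of_homogeneous hP.continuous hom
      (hψ.differentiableAt (by simp)) h0 h
    have hφd := ((hφ.differentiableAt
      (by simp)).hasFDerivAt.hasLineDerivAt h).tendsto_slope_zero_right
    refine ⟨_, (hφd.add hd).congr' ?_⟩
    have hmap : Tendsto (fun t : ℝ => w + t • h) (𝓝[>] 0) (𝓝 w) := by
      have : Continuous fun t : ℝ => w + t • h := by fun_prop
      simpa using (this.tendsto 0).mono_left nhdsWithin_le_nhds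
    filter_upwards [hmap.eventually hf] with t ht
    rw [ht, hf.self_of_nhds, ← smul_add]
    congr 1
    abel
  · filter_upwards [h₁, h₂, hf.eventually_nhds] with u hu₁ hu₂ hfu hd
    -- P ∘ ψ inherits differentiability at u from f and φ.
    have hPψ : (fun x => P (ψ x)) =ᶠ[𝓝 u] fun x => f x - φ x := by
      filter_upwards [hfu] with x hx
      rw [hx, add_sub_cancel_left]
    have hdP : DifferentiableAt ℝ (fun x => P (ψ x)) u :=
      (hd.sub hu₁.1).congr_of_eventuallyEq hPψ
    have hder : fderiv ℝ f u = fderiv ℝ φ u + fderiv ℝ (fun x => P (ψ x)) u := by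
      have hfu' : f =ᶠ[𝓝 u] fun x => φ x + P (ψ x) := hfu
      rw [hfu'.fderiv_eq, fderiv_fun_add hu₁.1 hdP]
    have key := norm_comp_sub_fderiv_le hP hom hu₂.1 hdP (u - w)
    have hb := hu₂.2
    rw [h0, sub_zero] at hb
    rw [hfu.self_of_nhds, hf.self_of_nhds, hder, h0, hP0, add_zero, _root_.add_apply]
    calc _ = ‖(φ u - φ w - fderiv ℝ φ u (u - w)) +
          (P (ψ u) - fderiv ℝ (fun x => P (ψ x)) u (u - w))‖ := by congr 1; abel
      _ ≤ C₁ * ‖u - w‖ ^ 2 + K * (C₂ * ‖u - w‖ ^ 2) :=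
        (norm_add_le _ _).trans (add_le_add hu₁.2 (key.trans (by gcongr)))
      _ = _ := by ring

end SemismoothCriterion

/-! ### The projection as a spectral function. -/

section Projection

namespace Matrix

variable {n : ℕ}

theorem frobenius_norm_sq_eq_trace (A : Matrix (Fin n) (Fin n) ℝ) :
    ‖A‖ ^ 2 = (Aᵀ * A).trace := by
  rw [frobenius_norm_def, ← Real.sqrt_eq_rpow, Real.sq_sqrt (by positivity), Finset.sum_comm]
  simp [trace, mul_apply, sq]

theorem frobenius_norm_add_sq (A B : Matrix (Fin n) (Fin n) ℝ) :
    ‖A + B‖ ^ 2 = ‖A‖ ^ 2 + 2 * (Aᵀ * B).trace + ‖B‖ ^ 2 := by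
  have h : (Bᵀ * A).trace = (Aᵀ * B).trace := by
    rw [← trace_transpose, transpose_mul, transpose_transpose]
  simp only [frobenius_norm_sq_eq_trace, transpose_add, add_mul, mul_add, trace_add, h]
  ring

theorem PosSemidef.trace_mul_nonneg {A B : Matrix (Fin n) (Fin n) ℝ} (hA : A.PosSemidef)
    (hB : B.PosSemidef) : 0 ≤ (A * B).trace := by
  obtain ⟨m, v, rfl⟩ := posSemidef_iff_eq_sum_vecMulVec.1 hB
  rw [Finset.mul_sum, trace_sum]
  refine Finset.sum_nonneg fun i _ => ?_
  rw [mul_vecMulVec, trace_vecMulVec, dotProduct_comm]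
  exact hA.dotProduct_mulVec_nonneg _

theorem trace_transpose_mul_eq_zero {A B : Matrix (Fin n) (Fin n) ℝ} (hA : Aᵀ = -A)
    (hB : Bᵀ = B) : (Aᵀ * B).trace = 0 := by
  have h : (Aᵀ * B).trace = (A * B).trace := by
    rw [← trace_transpose, transpose_mul, transpose_transpose, hB, trace_mul_comm]
  have h' : (Aᵀ * B).trace = -(A * B).trace := by rw [hA, neg_mul, trace_neg]
  linarith

/-- The symmetric part of a square matrix. -/
noncomputable def symPart (Z : Matrix (Fin n) (Fin n) ℝ) : Matrix (Fin n) (Fin n) ℝ :=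
  (1 / 2 : ℝ) • (Z + Zᵀ)

theorem symPart_transpose (Z : Matrix (Fin n) (Fin n) ℝ) : (symPart Z)ᵀ = symPart Z := by
  simp [symPart, add_comm]

theorem isSelfAdjoint_symPart (Z : Matrix (Fin n) (Fin n) ℝ) : IsSelfAdjoint (symPart Z) := by
  rw [IsSelfAdjoint, star_eq_conjTranspose, conjTranspose_eq_transpose_of_trivial,
    symPart_transpose]

theorem symPart_of_isSelfAdjoint {S : Matrix (Fin n) (Fin n) ℝ} (hS : IsSelfAdjoint S) :
    symPart S = S := by
  have h : Sᵀ = S := by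
    rwa [IsSelfAdjoint, star_eq_conjTranspose, conjTranspose_eq_transpose_of_trivial] at hS
  rw [symPart, h, ← two_smul ℝ S, smul_smul]
  norm_num

theorem sub_symPart_transpose (Z : Matrix (Fin n) (Fin n) ℝ) :
    (Z - symPart Z)ᵀ = -(Z - symPart Z) := by
  rw [transpose_sub, symPart_transpose, symPart]
  module

theorem posSemidef_cfc (S : Matrix (Fin n) (Fin n) ℝ) {f : ℝ → ℝ}
    (hf : Continuous f) (h0 : ∀ x, 0 ≤ f x) : (cfc f S).PosSemidef := by
  have h : cfc f S = (cfc (fun x => √(f x)) S)ᴴ * cfc (fun x => √(f x)) S := by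
    rw [← star_eq_conjTranspose, (cfc_predicate (fun x => √(f x)) S : IsSelfAdjoint _).star_eq,
      ← cfc_mul (fun x => √(f x)) (fun x => √(f x)) S]
    simp [Real.mul_self_sqrt, h0]
  rw [h]
  exact posSemidef_conjTranspose_mul_self _

end Matrix

open Matrix

variable {n : ℕ}

/-- Variational inequality for the projection. With S = A - N the splitting into positive and
negative parts, Z - A is a skew matrix, orthogonal to symmetric ones, minus N; then NA = 0 and
tr(NY) ≥ 0 conclude. -/
theorem trace_sub_cfc_max_mul_nonneg (Z : Matrix (Fin n) (Fin n) ℝ)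
    {Y : Matrix (Fin n) (Fin n) ℝ} (hY : Y.PosSemidef) :
    0 ≤ ((Z - cfc (fun x : ℝ => max x 0) (symPart Z))ᵀ *
      (cfc (fun x : ℝ => max x 0) (symPart Z) - Y)).trace := by
  have hS := isSelfAdjoint_symPart Z
  set S := symPart Z with hSdef
  set A := cfc (fun x : ℝ => max x 0) S with hA
  set N := cfc (fun x : ℝ => max (-x) 0) S with hN
  have hA' : A.PosSemidef := posSemidef_cfc S (by fun_prop) fun x => le_max_right _ _
  have hN' : N.PosSemidef := posSemidef_cfc S (by fun_prop) fun x => le_max_right _ _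
  have hNA : N * A = 0 := by
    rw [hA, hN, ← cfc_mul _ _ S, ← cfc_const_zero ℝ S]
    refine cfc_congr fun x _ => ?_
    rcases le_total x 0 with h | h <;> simp [h]
  have hAN : S = A - N := by
    rw [hA, hN, ← cfc_sub _ _ S]
    conv_lhs => rw [← cfc_id ℝ S]
    refine cfc_congr fun x _ => ?_
    rcases le_total x 0 with h | h <;> simp [h]
  have hAt : Aᵀ = A := by simpa using hA'.isHermitian.eq
  have hNt : Nᵀ = N := by simpa using hN'.isHermitian.eq
  have hYt : Yᵀ = Y := by simpa using hY.isHermitian.eq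
  have hsplit : Z - A = (Z - S) + -N := by rw [hAN]; abel
  rw [hsplit, transpose_add, add_mul, trace_add,
    trace_transpose_mul_eq_zero (sub_symPart_transpose Z) (by simp [hAt, hYt]), transpose_neg, hNt,
    neg_mul, mul_sub, hNA]
  simpa using hN'.trace_mul_nonneg hY

theorem projPSD_eq_cfc (Z : Matrix (Fin n) (Fin n) ℝ) :
    projPSD Z = cfc (fun x : ℝ => max x 0) (symPart Z) := by
  have hQ : (cfc (fun x : ℝ => max x 0) (symPart Z)).PosSemidef :=
    posSemidef_cfc _ (by fun_prop) fun x => le_max_right _ _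
  obtain ⟨hP, hmin⟩ := (exists_nearest_psdCone Z).choose_spec
  have hv := trace_sub_cfc_max_mul_nonneg Z hP
  have hle := hmin _ hQ
  change ‖Z - projPSD Z‖ ≤ _ at hle
  change 0 ≤ (_ * (_ - projPSD Z)).trace at hv
  set Q := cfc (fun x : ℝ => max x 0) (symPart Z)
  have hsq := frobenius_norm_add_sq (Z - Q) (Q - projPSD Z)
  rw [sub_add_sub_cancel] at hsq
  have h0 : ‖Q - projPSD Z‖ ^ 2 = 0 := by
    refine le_antisymm ?_ (sq_nonneg _)
    nlinarith [norm_nonneg (Z - projPSD Z)]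
  exact (sub_eq_zero.1 (norm_eq_zero.1 (pow_eq_zero_iff two_ne_zero |>.1 h0))).symm

theorem projPSD_posSemidef (Z : Matrix (Fin n) (Fin n) ℝ) : (projPSD Z).PosSemidef :=
  (exists_nearest_psdCone Z).choose_spec.1

/-- Adding the variational inequalities at Z and W makes the cross term in the expansion of ‖Z - W‖²
nonnegative. -/
theorem lipschitzWith_projPSD : LipschitzWith 1 (projPSD (n := n)) := by
  refine LipschitzWith.of_dist_le_mul fun Z W => ?_
  rw [dist_eq_norm, dist_eq_norm, NNReal.coe_one, one_mul]
  have h1 := trace_sub_cfc_max_mul_nonneg Z (projPSD_posSemidef W)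
  have h2 := trace_sub_cfc_max_mul_nonneg W (projPSD_posSemidef Z)
  rw [← projPSD_eq_cfc] at h1 h2
  have hsq := frobenius_norm_add_sq ((Z - W) - (projPSD Z - projPSD W)) (projPSD Z - projPSD W)
  rw [sub_add_cancel] at hsq
  have h3 : (((Z - W) - (projPSD Z - projPSD W))ᵀ * (projPSD Z - projPSD W)).trace =
      ((Z - projPSD Z)ᵀ * (projPSD Z - projPSD W)).trace +
        ((W - projPSD W)ᵀ * (projPSD W - projPSD Z)).trace := by
    rw [← trace_add, ← neg_sub (projPSD Z) (projPSD W), mul_neg, ← sub_eq_add_neg, ← sub_mul,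
      ← transpose_sub]
    congr 3
    abel
  refine abs_le_of_sq_le_sq' ?_ (norm_nonneg _) |>.2
  nlinarith [sq_nonneg ‖(Z - W) - (projPSD Z - projPSD W)‖]

theorem projPSD_cfc {S : Matrix (Fin n) (Fin n) ℝ} (hS : IsSelfAdjoint S) {f : ℝ → ℝ}
    (hf : Continuous f) : projPSD (cfc f S) = cfc (fun x => max (f x) 0) S := by
  rw [projPSD_eq_cfc, symPart_of_isSelfAdjoint (cfc_predicate f S),
    ← cfc_comp' (fun x : ℝ => max x 0) f S]

theorem projPSD_symPart (Z : Matrix (Fin n) (Fin n) ℝ) : projPSD (symPart Z) = projPSD Z := by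
  rw [projPSD_eq_cfc, projPSD_eq_cfc, symPart_of_isSelfAdjoint (isSelfAdjoint_symPart Z)]

theorem symPart_smul_sub_smul_one (c b : ℝ) (Z : Matrix (Fin n) (Fin n) ℝ) :
    symPart (c • Z - b • (1 : Matrix (Fin n) (Fin n) ℝ)) =
      cfc (fun x => c * x - b) (symPart Z) := by
  have hS := isSelfAdjoint_symPart Z
  rw [cfc_sub (fun x => c * x) (fun _ => b) (symPart Z), cfc_const_mul_id c (symPart Z),
    cfc_const b (symPart Z), Algebra.algebraMap_eq_smul_one]
  simp only [symPart, transpose_smul, transpose_sub, transpose_one]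
  module

/-- The projection of an affine image of a matrix, in terms of the functional calculus of the
symmetric part of the matrix. -/
theorem projPSD_smul_sub_smul_one (c b : ℝ) (Z : Matrix (Fin n) (Fin n) ℝ) :
    projPSD (c • Z - b • (1 : Matrix (Fin n) (Fin n) ℝ)) =
      cfc (fun x => max (c * x - b) 0) (symPart Z) := by
  rw [← projPSD_symPart, symPart_smul_sub_smul_one,
    projPSD_cfc (isSelfAdjoint_symPart Z) (by fun_prop)]

theorem projPSD_smul {t : ℝ} (ht : 0 ≤ t) (Z : Matrix (Fin n) (Fin n) ℝ) :
    projPSD (t • Z) = t • projPSD Z := by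
  have h := projPSD_smul_sub_smul_one t 0 Z
  rw [zero_smul, sub_zero] at h
  rw [h, projPSD_eq_cfc, ← cfc_smul t (fun x : ℝ => max x 0) (symPart Z)]
  refine cfc_congr fun x _ => ?_
  simp [mul_max_of_nonneg _ _ ht]

end Projection

/-! ### Smoothness off the singular matrices and local decomposition. -/

section Decomposition

open Matrix

variable {n : ℕ}

/-- Makes the derivative of squaring at A invertible. Multiplying by Hᴴ and taking traces gives two
nonnegative terms with sum zero. -/
theorem Matrix.PosDef.eq_zero_of_mul_add_mul_eq_zero {A H : Matrix (Fin n) (Fin n) ℝ}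
    (hA : A.PosDef) (h : A * H + H * A = 0) : H = 0 := by
  have h1 : (Hᴴ * A * H).PosSemidef := hA.posSemidef.conjTranspose_mul_mul_same H
  have h2 : (H * A * Hᴴ).PosSemidef := hA.posSemidef.mul_mul_conjTranspose_same H
  have h3 : (Hᴴ * A * H).trace + (H * A * Hᴴ).trace = 0 := by
    rw [trace_mul_comm (H * A), mul_assoc Hᴴ A H, ← trace_add, ← mul_add, h, mul_zero, trace_zero]
  have h4 : Hᴴ * A * H = 0 := h1.trace_eq_zero_iff.1 (by
    linarith [h1.trace_nonneg, h2.trace_nonneg])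
  refine ext_of_mulVec_single fun i => ?_
  rw [zero_mulVec]
  by_contra hv
  have h5 := hA.dotProduct_mulVec_pos hv
  rw [star_mulVec, ← dotProduct_mulVec, mulVec_mulVec, mulVec_mulVec, h4] at h5
  simp at h5

/-- Near a positive definite matrix, the squaring map has a smooth left inverse. -/
theorem Matrix.PosDef.exists_contDiffAt_sqrt {A : Matrix (Fin n) (Fin n) ℝ} (hA : A.PosDef) :
    ∃ g : Matrix (Fin n) (Fin n) ℝ → Matrix (Fin n) (Fin n) ℝ,
      ContDiffAt ℝ 2 g (A * A) ∧ ∀ᶠ X in 𝓝 A, g (X * X) = X := by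
  let D : Matrix (Fin n) (Fin n) ℝ →ₗ[ℝ] Matrix (Fin n) (Fin n) ℝ :=
    LinearMap.mulLeft ℝ A + LinearMap.mulRight ℝ A
  have hD : Function.Injective D :=
    (injective_iff_map_eq_zero D).2 fun H hH => hA.eq_zero_of_mul_add_mul_eq_zero hH
  let e := (LinearEquiv.ofInjectiveEndo D hD).toContinuousLinearEquiv
  have hc : ContDiffAt ℝ 2 (fun X : Matrix (Fin n) (Fin n) ℝ => X * X) A :=
    contDiffAt_id.mul contDiffAt_id
  have hd : HasFDerivAt (fun X : Matrix (Fin n) (Fin n) ℝ => X * X)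
      (e : Matrix (Fin n) (Fin n) ℝ →L[ℝ] Matrix (Fin n) (Fin n) ℝ) A := by
    refine ((hasFDerivAt_id A).mul' (hasFDerivAt_id A)).congr_fderiv ?_
    ext1 H
    rfl
  exact ⟨_, hc.to_localInverse hd two_ne_zero,
    (hc.hasStrictFDerivAt' hd two_ne_zero).eventually_left_inverse⟩

theorem contDiff_symPart : ContDiff ℝ 2 (symPart (n := n)) := by
  let T : Matrix (Fin n) (Fin n) ℝ →ₗ[ℝ] Matrix (Fin n) (Fin n) ℝ :=
    (1 / 2 : ℝ) • (LinearMap.id + (transposeLinearEquiv (Fin n) (Fin n) ℝ ℝ).toLinearMap)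
  exact T.toContinuousLinearMap.contDiff

/-- The projection onto the semidefinite cone is smooth at matrices with invertible symmetric
part. -/
theorem contDiffAt_projPSD {W : Matrix (Fin n) (Fin n) ℝ} (hW : IsUnit (symPart W)) :
    ContDiffAt ℝ 2 projPSD W := by
  -- max(x, 0) = (x + |x|)/2 and |S| is the square root of S², smooth where |S| is positive
  -- definite.
  have habs (Y : Matrix (Fin n) (Fin n) ℝ) :
      (2 : ℝ) • projPSD Y - symPart Y = cfc (fun x : ℝ => |x|) (symPart Y) := by
    have hS := isSelfAdjoint_symPart Y
    rw [projPSD_eq_cfc, ← cfc_smul (2 : ℝ) (fun x : ℝ => max x 0) (symPart Y)]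
    nth_rw 2 [← cfc_id ℝ (symPart Y)]
    rw [← cfc_sub _ _ (symPart Y)]
    refine cfc_congr fun x _ => ?_
    rcases le_total x 0 with h | h <;> simp [h, abs_of_nonneg, abs_of_nonpos]
    ring
  have hsq (Y : Matrix (Fin n) (Fin n) ℝ) :
      cfc (fun x : ℝ => |x|) (symPart Y) * cfc (fun x : ℝ => |x|) (symPart Y) =
        symPart Y * symPart Y := by
    have hS := isSelfAdjoint_symPart Y
    conv_rhs => rw [← cfc_id ℝ (symPart Y)]
    rw [← cfc_mul _ _ (symPart Y), ← cfc_mul _ _ (symPart Y)]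
    exact cfc_congr fun x _ => abs_mul_abs_self x
  have hS := isSelfAdjoint_symPart W
  have hpos : (cfc (fun x : ℝ => |x|) (symPart W)).PosDef := by
    refine (posSemidef_cfc _ (by fun_prop) abs_nonneg).posDef_iff_isUnit.2 ?_
    rw [isUnit_cfc_iff _ _]
    rintro x hx h
    rw [abs_eq_zero.1 h] at hx
    exact spectrum.zero_notMem ℝ hW hx
  obtain ⟨g, hg, hginv⟩ := hpos.exists_contDiffAt_sqrt
  -- Continuity keeps |S| in the neighbourhood where `g` inverts squaring.
  have hcont : Continuous fun Y : Matrix (Fin n) (Fin n) ℝ =>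
      cfc (fun x : ℝ => |x|) (symPart Y) := by
    simp only [← habs]
    exact (lipschitzWith_projPSD.continuous.const_smul (2 : ℝ)).sub
      (contDiff_symPart (n := n)).continuous
  have heq : projPSD =ᶠ[𝓝 W] fun Y => (1 / 2 : ℝ) • (g (symPart Y * symPart Y) + symPart Y) := by
    filter_upwards [(hcont.tendsto W).eventually hginv] with Y hY
    rw [← hsq, hY, ← habs]
    module
  refine ContDiffAt.congr_of_eventuallyEq ?_ heq
  have hs : ContDiffAt ℝ 2 (symPart (n := n)) W := contDiff_symPart.contDiffAt
  rw [hsq] at hg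
  exact ((ContDiffAt.comp W hg (hs.mul hs)).add hs).const_smul _

theorem contDiffAt_projPSD_smul_sub_smul_one {c b : ℝ} {Z : Matrix (Fin n) (Fin n) ℝ}
    (h : ∀ x ∈ spectrum ℝ (symPart Z), c * x - b ≠ 0) :
    ContDiffAt ℝ 2 (fun Y => projPSD (c • Y - b • (1 : Matrix (Fin n) (Fin n) ℝ))) Z := by
  have hS := isSelfAdjoint_symPart Z
  have hu : IsUnit (symPart (c • Z - b • (1 : Matrix (Fin n) (Fin n) ℝ))) := by
    rw [symPart_smul_sub_smul_one]
    exact (isUnit_cfc_iff _ _).2 h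
  refine ContDiffAt.comp Z (contDiffAt_projPSD hu) ?_
  fun_prop

theorem Set.Finite.exists_pos_lt_abs {s : Set ℝ} (hs : s.Finite) :
    ∃ c > 0, ∀ x ∈ s, x ≠ 0 → c < |x| := by
  have h : ∀ᶠ c in 𝓝[>] (0 : ℝ), ∀ x ∈ s, x ≠ 0 → c < |x| := by
    refine (Filter.eventually_all_finite hs).2 fun x _ => ?_
    by_cases hx : x = 0
    · simp [hx]
    · filter_upwards [nhdsWithin_le_nhds (Iio_mem_nhds (abs_pos.2 hx))] with c hc _ using hc
  obtain ⟨c, hc, hpos⟩ := (h.and self_mem_nhdsWithin).exists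
  exact ⟨c, hpos, hc⟩

/-- Near any `Z`, the projection is a smooth map plus the projection of a smooth map vanishing
at `Z`. -/
theorem exists_projPSD_eq_add_projPSD (Z : Matrix (Fin n) (Fin n) ℝ) :
    ∃ F G : Matrix (Fin n) (Fin n) ℝ → Matrix (Fin n) (Fin n) ℝ,
      ContDiffAt ℝ 2 F Z ∧ ContDiffAt ℝ 2 G Z ∧ G Z = 0 ∧
        ∀ Y, projPSD Y = F Y + projPSD (G Y) := by
  obtain ⟨c, hc, hgap⟩ := (symPart Z).finite_real_spectrum.exists_pos_lt_abs
  let p (s b : ℝ) (Y : Matrix (Fin n) (Fin n) ℝ) : Matrix (Fin n) (Fin n) ℝ :=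
    projPSD (s • Y - b • (1 : Matrix (Fin n) (Fin n) ℝ))
  -- The kink ±b lies in the gap between 0 and the nonzero eigenvalues.
  have hp (s b : ℝ) (hs : |s| = 1) (hb : 0 < b) (hbc : b ≤ c) : ContDiffAt ℝ 2 (p s b) Z := by
    refine contDiffAt_projPSD_smul_sub_smul_one fun x hx h => ?_
    have hsx : |x| = b := by
      rw [← abs_of_pos hb, ← sub_eq_zero.1 h, abs_mul, hs, one_mul]
    have hx0 : x ≠ 0 := by
      rintro rfl
      simp at hsx
      exact hb.ne hsx
    linarith [hgap x hx hx0]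
  have h1 := hp 1 (c / 2) (by simp) (by positivity) (by linarith)
  have h2 := hp 1 c (by simp) hc le_rfl
  have h3 := hp (-1) (c / 2) (by simp) (by positivity) (by linarith)
  have h4 := hp (-1) c (by simp) hc le_rfl
  -- `f` and `g` are piecewise linear, with `max x 0 = f x + max (g x) 0`.
  let f (x : ℝ) : ℝ := 2 * max (1 * x - c / 2) 0 - max (1 * x - c) 0
  let k (x : ℝ) : ℝ := 2 * max (-1 * x - c / 2) 0 - max (-1 * x - c) 0
  let g (x : ℝ) : ℝ := x - f x + k x
  have hfc : Continuous f := by fun_prop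
  have hkc : Continuous k := by fun_prop
  have hgc : Continuous g := by fun_prop
  have hF (s : ℝ) (Y : Matrix (Fin n) (Fin n) ℝ) : (2 : ℝ) • p s (c / 2) Y - p s c Y =
      cfc (fun x => 2 * max (s * x - c / 2) 0 - max (s * x - c) 0) (symPart Y) := by
    simp only [p, projPSD_smul_sub_smul_one]
    rw [← cfc_smul (2 : ℝ) (fun x => max (s * x - c / 2) 0) (symPart Y),
      ← cfc_sub _ _ (symPart Y)]
    rfl
  have hG (Y : Matrix (Fin n) (Fin n) ℝ) : symPart Y - ((2 : ℝ) • p 1 (c / 2) Y - p 1 c Y) +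
      ((2 : ℝ) • p (-1) (c / 2) Y - p (-1) c Y) = cfc g (symPart Y) := by
    have hS := isSelfAdjoint_symPart Y
    rw [hF, hF]
    nth_rw 1 [← cfc_id ℝ (symPart Y)]
    rw [← cfc_sub _ _ (symPart Y), ← cfc_add (symPart Y) _ _]
    rfl
  refine ⟨fun Y => (2 : ℝ) • p 1 (c / 2) Y - p 1 c Y,
    fun Y => symPart Y - ((2 : ℝ) • p 1 (c / 2) Y - p 1 c Y) +
      ((2 : ℝ) • p (-1) (c / 2) Y - p (-1) c Y), (h1.const_smul _).sub h2,
    (contDiff_symPart.contDiffAt.sub ((h1.const_smul _).sub h2)).add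
      ((h3.const_smul _).sub h4), ?_, fun Y => ?_⟩
  -- `g` vanishes at 0 and for |x| ≥ c, hence on the spectrum at Z.
  · simp only [hG]
    rw [← cfc_const_zero ℝ (symPart Z)]
    refine cfc_congr fun x hx => ?_
    by_cases hx0 : x = 0
    · subst hx0
      simp only [g, f, k]
      grind
    · have := hgap x hx hx0
      simp only [g, f, k]
      rcases abs_cases x with ⟨h, _⟩ | ⟨h, _⟩ <;> grind
  · simp only [hG]
    rw [hF, projPSD_cfc (isSelfAdjoint_symPart Y) hgc, ← cfc_add (symPart Y) _ _, projPSD_eq_cfc]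
    refine cfc_congr fun x _ => ?_
    simp only [g, f, k]
    grind

end Decomposition

/-! ### Application to the residual map. -/

section Residual

open Matrix

variable {n : ℕ} {E F : Type*} [NormedAddCommGroup E] [NormedSpace ℝ E]
  [NormedAddCommGroup F] [NormedSpace ℝ F]

theorem LinearMap.exists_lipschitzWith [FiniteDimensional ℝ E] (T : E →ₗ[ℝ] F) :
    ∃ K, LipschitzWith K T :=
  ⟨_, T.toContinuousLinearMap.lipschitz⟩

theorem LinearMap.contDiff_of_finiteDimensional [FiniteDimensional ℝ E] (T : E →ₗ[ℝ] F) :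
    ContDiff ℝ 2 T :=
  T.toContinuousLinearMap.contDiff

/-- Sums of an affine map and a linear image of the projection of an affine map are strongly
semismooth. -/
theorem stronglySemismooth_affine_add_projPSD [FiniteDimensional ℝ E] (L : E →ₗ[ℝ] F) (c : F)
    (ι : Matrix (Fin n) (Fin n) ℝ →ₗ[ℝ] F) (A : E →ₗ[ℝ] Matrix (Fin n) (Fin n) ℝ)
    (b : Matrix (Fin n) (Fin n) ℝ) :
    StronglySemismooth fun w => L w + c + ι (projPSD (A w + b)) := by
  obtain ⟨K₁, hL⟩ := L.exists_lipschitzWith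
  obtain ⟨K₂, hι⟩ := ι.exists_lipschitzWith
  obtain ⟨K₃, hA⟩ := A.exists_lipschitzWith
  have hιP : LipschitzWith (K₂ * 1) fun X => ι (projPSD X) := hι.comp lipschitzWith_projPSD
  have hlip : LipschitzWith (K₁ + 0 + K₂ * 1 * (K₃ + 0))
      fun w => L w + c + ι (projPSD (A w + b)) :=
    (hL.add (LipschitzWith.const c)).add (hιP.comp (hA.add (LipschitzWith.const b)))
  refine ⟨⟨_, hlip⟩, fun w => ?_⟩
  obtain ⟨f, g, hf, hg, h0, hfg⟩ := exists_projPSD_eq_add_projPSD (A w + b)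
  have hA : ContDiffAt ℝ 2 (fun w => A w + b) w :=
    A.contDiff_of_finiteDimensional.contDiffAt.add contDiffAt_const
  refine .of_eventuallyEq_add_comp (φ := fun u => L u + c + ι (f (A u + b)))
    (ψ := fun u => g (A u + b)) (P := fun X => ι (projPSD X)) hlip.continuous ?_
    (ContDiffAt.comp w hg hA) h0 hιP ?_ ?_
  · have h1 : ContDiffAt ℝ 2 (fun u => L u + c) w :=
      L.contDiff_of_finiteDimensional.contDiffAt.add contDiffAt_const
    exact h1.add (ι.contDiff_of_finiteDimensional.contDiffAt.comp w (ContDiffAt.comp w hf hA))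
  · intro t ht X
    rw [projPSD_smul ht, map_smul]
  · refine Eventually.of_forall fun u => ?_
    rw [hfg (A u + b), map_add, add_assoc, add_assoc, add_assoc]

/-- The linear part of the residual map outside the projection. -/
noncomputable def residualLinear (Q : Matrix (Fin n) (Fin n) ℝ) (Φ : Fin n → Fin n → ℝ)
    (lam₂ : ℝ) : PairSpace n →ₗ[ℝ] PairSpace n where
  toFun w := WithLp.toLp 1
    (WithLp.toLp 2 ((1 / (2 * lam₂)) • (Q *ᵥ w.fst.ofLp) - opPhi Φ w.snd), w.snd)
  map_add' v w := by
    refine (WithLp.ofLp_injective 1) (Prod.ext ((WithLp.ofLp_injective 2) ?_) ?_)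
    · ext i
      simp [opPhi, mulVec_add, add_mul]
      ring
    · simp
  map_smul' t w := by
    refine (WithLp.ofLp_injective 1) (Prod.ext ((WithLp.ofLp_injective 2) ?_) ?_)
    · ext i
      simp [opPhi, mulVec_smul]
      ring
    · simp

/-- The linear part of the argument of the projection in the residual map. -/
noncomputable def residualArgLinear (Φ : Fin n → Fin n → ℝ) :
    PairSpace n →ₗ[ℝ] Matrix (Fin n) (Fin n) ℝ where
  toFun w := w.snd - opPhiAdj Φ w.fst.ofLp
  map_add' v w := by
    simp only [opPhiAdj, WithLp.add_snd, WithLp.add_fst, WithLp.ofLp_add, Pi.add_apply, add_smul,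
      Finset.sum_add_distrib]
    abel
  map_smul' t w := by
    simp only [opPhiAdj, WithLp.smul_snd, WithLp.smul_fst, WithLp.ofLp_smul, Pi.smul_apply,
      smul_eq_mul, mul_smul, ← Finset.smul_sum, smul_sub, RingHom.id_apply]

/-- The inclusion of the matrix component, with a minus sign. -/
noncomputable def negInclusion (n : ℕ) : Matrix (Fin n) (Fin n) ℝ →ₗ[ℝ] PairSpace n :=
  -((WithLp.linearEquiv 1 ℝ (EuclideanSpace ℝ (Fin n) × Matrix (Fin n) (Fin n) ℝ)).symm.toLinearMap
    ∘ₗ LinearMap.inr ℝ _ _)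

theorem residualMap_eq (Q : Matrix (Fin n) (Fin n) ℝ) (z : Fin n → ℝ)
    (Φ : Fin n → Fin n → ℝ) (lam₁ lam₂ : ℝ) (w : PairSpace n) :
    residualMap Q z Φ lam₁ lam₂ w =
      residualLinear Q Φ lam₂ w + WithLp.toLp 1 (WithLp.toLp 2 (-((1 / (2 * lam₂)) • z)), 0) +
        negInclusion n (projPSD
          (residualArgLinear Φ w + -(lam₁ • (1 : Matrix (Fin n) (Fin n) ℝ)))) := by
  have harg : residualArgLinear Φ w + -(lam₁ • (1 : Matrix (Fin n) (Fin n) ℝ)) =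
      w.snd - (opPhiAdj Φ w.fst.ofLp + lam₁ • (1 : Matrix (Fin n) (Fin n) ℝ)) := by
    simp only [residualArgLinear, LinearMap.coe_mk, AddHom.coe_mk]
    abel
  rw [harg]
  refine (WithLp.ofLp_injective 1) (Prod.ext ((WithLp.ofLp_injective 2) ?_) ?_)
  · simp [residualMap, residualLinear, negInclusion]
    abel
  · simp [residualMap, residualLinear, negInclusion]
    abel

end Residual

theorem proposition2 {n : ℕ} (Q : Matrix (Fin n) (Fin n) ℝ) (z : Fin n → ℝ)
    (Φ : Fin n → Fin n → ℝ) (lam₁ lam₂ : ℝ) (hlam₁ : 0 < lam₁) (hlam₂ : 0 < lam₂) :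
    StronglySemismooth (residualMap Q z Φ lam₁ lam₂) := by
  have h := stronglySemismooth_affine_add_projPSD (residualLinear Q Φ lam₂)
    (WithLp.toLp 1 (WithLp.toLp 2 (-((1 / (2 * lam₂)) • z)), 0))
    (negInclusion n) (residualArgLinear Φ)
    (-(lam₁ • (1 : Matrix (Fin n) (Fin n) ℝ)))
  convert h using 1
  funext w
  exact residualMap_eq Q z Φ lam₁ lam₂ w
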